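/- Let $n\ge 2$, $K\ge 1$, and let $D_1,D_2\subset\mathbb R^n$ be bounded open sets with Lipschitz boundary such that $\overline{D_1}\subset D_2$ and $D_2\setminus\overline{D_1}$ is connected; let $\Gamma$ be a nonempty relatively open subset of $\partial D_2$. Let $L=\partial_i a^{ij}\partial_j+c$ (real coefficients, summation convention), where $(a^{ij})$ is measurable and symmetric with $K^{-1}|\xi|^2\le a^{ij}(x)\xi_i\xi_j\le K|\xi|^2$ for a.e. $x\in D_2$ and all $\xi\in\mathbb R^n$, $\|c\|_{L^\infty(D_2)}\le K$, and, if $n\ge 3$, also $\|\nabla a^{ij}\|_{L^\infty(D_2)}\le K$ for all $i,j$. Then $L^*=L$. Assume that $0$ is not a Dirichlet eigenvalue of $L$ in $D_2$. All equations are understood in the weak sense. Let $\widetilde H^{1/2}(\Gamma)$ be the closure in $H^{1/2}(\partial D_2)$ of $\{g\in H^{1/2}(\partial D_2):\operatorname{supp} g\subset\Gamma\}$, and let $H^{-1/2}(\Gamma)$ be its dual space with the dual norm. Set $$S_1=\{h\in H^1(D_1): Lh=0\text{ in }D_1\},\qquad S_2=\{u\in H^1(D_2): Lu=0\text{ in }D_2,\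 u|_{\partial D_2}\in\widetilde H^{1/2}(\Gamma)\}.$$ Let $\mu>0$ and $C>1$ and assume that quantitative Runge approximation holds with these constants: for each $h\in S_1$ and each $\epsilon\in(0,1)$ there exists $u\in S_2$ with $$\|h-u\|_{L^2(D_1)}\le\epsilon\|h\|_{H^1(D_1)},\qquad \|u\|_{H^{1/2}(\partial D_2)}\le Ce^{C\epsilon^{-\mu}}\|h\|_{L^2(D_1)}.$$ Then there is a constant $C'>1$, depending only on $\mu$ and $C$, with the following property. Let $h\in S_1$ and let $w\in H^1(D_2)$ be a solution of $$L^*w=\begin{cases}h&\text{in }D_1,\\0&\text{in }D_2\setminus\overline{D_1},\end{cases}\qquad w=0\text{ on }\partial D_2 .$$ Then $$\|h\|_{L^2(D_1)}\le C'e^{C'\epsilon^{-\mu}}\,\|\partial_\nu w\|_{H^{-1/2}(\Gamma)}$$ for every $\epsilon>0$ with $\epsilon\|h\|_{H^1(D_1)}\le\frac12\|h\|_{L^2(D_1)}$. Here the conormal derivative $\partial_\nu w$ is defined weakly by $$(\partial_\nu w,g)=\int_{D_2}\bigl(a^{ij}\,\partial_i w\,\partial_j v+(h1_{D_1}-cw)\,v\bigr)\,dx$$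 for $g\in H^{1/2}(\partial D_2)$, with $v\in H^1(D_2)$ any extension of $g$. -/

import Mathlib

open MeasureTheory Filter Topology
open scoped ENNReal NNReal ContDiff Gradient

noncomputable section

/-- The Euclidean space `ℝⁿ`. -/
abbrev Euc (n : ℕ) : Type := EuclideanSpace ℝ (Fin n)

/-- A bounded open set with Lipschitz boundary: near every boundary point the set is, for a suitable
unit vector `e`, the part of a ball lying strictly above the graph (over the hyperplane `e^⊥`, in the
direction `e`) of a Lipschitz function `γ`.  Only the values of `γ` on `e^⊥` matter. -/
structure IsBoundedLipschitz {n : ℕ} (Ω : Set (Euc n)) : Prop where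
  isOpen : IsOpen Ω
  isBounded : Bornology.IsBounded Ω
  graph : ∀ x ∈ frontier Ω, ∃ r : ℝ, 0 < r ∧ ∃ e : Euc n, ‖e‖ = 1 ∧
    ∃ γ : Euc n → ℝ, (∃ M : ℝ≥0, LipschitzWith M γ) ∧
      ∀ y ∈ Metric.ball x r, (y ∈ Ω ↔ γ (y - inner ℝ e y • e) < inner ℝ e y)

/-- `φ ∈ C_c^∞(Ω)`. -/
structure IsTestFunction {n : ℕ} (Ω : Set (Euc n)) (φ : Euc n → ℝ) : Prop where
  smooth : ContDiff ℝ ∞ φ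
  compact : HasCompactSupport φ
  supp : tsupport φ ⊆ Ω

/-- `G` is the distributional gradient of `u` in `Ω` (for `u` and `G` locally integrable there):
`∫_Ω u ∂ᵢφ = - ∫_Ω Gᵢ φ` for all test functions `φ`. -/
def HasWeakGradient {n : ℕ} (Ω : Set (Euc n)) (u : Euc n → ℝ) (G : Euc n → Euc n) : Prop :=
  ∀ φ : Euc n → ℝ, IsTestFunction Ω φ → ∀ i : Fin n,
    ∫ x in Ω, u x * (∇ φ x) i = - ∫ x in Ω, G x i * φ x

/-- A (representative of a) real-valued function in `H¹(Ω)`, together with (a representative of)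
its weak gradient.  Values outside `Ω` are irrelevant. -/
structure HOne {n : ℕ} (Ω : Set (Euc n)) where
  toFun : Euc n → ℝ
  grad : Euc n → Euc n
  memLp : MemLp toFun 2 (volume.restrict Ω)
  memLp_grad : MemLp grad 2 (volume.restrict Ω)
  weak : HasWeakGradient Ω toFun grad

/-- The `L²(Ω)` norm (used for functions that are square integrable on `Ω`). -/
def l2Norm {n : ℕ} (Ω : Set (Euc n)) (f : Euc n → ℝ) : ℝ :=
  Real.sqrt (∫ x in Ω, f x ^ 2)

/-- The `H¹(Ω)` norm. -/
def hOneNorm {n : ℕ} {Ω : Set (Euc n)} (u : HOne Ω) : ℝ :=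
  Real.sqrt ((∫ x in Ω, u.toFun x ^ 2) + ∫ x in Ω, ‖u.grad x‖ ^ 2)

/-- Convergence in `H¹(Ω)` of a sequence of smooth functions `φ k` to `u`. -/
def TendstoHOne {n : ℕ} {Ω : Set (Euc n)} (φ : ℕ → Euc n → ℝ) (u : HOne Ω) : Prop :=
  Tendsto (fun k => eLpNorm (fun x => φ k x - u.toFun x) 2 (volume.restrict Ω)) atTop (𝓝 0) ∧
  Tendsto (fun k => eLpNorm (fun x => ∇ (φ k) x - u.grad x) 2 (volume.restrict Ω)) atTop (𝓝 0)

/-- `u ∈ H¹₀(Ω)`, the closure of `C_c^∞(Ω)` in `H¹(Ω)`; that is, `u = 0` on `∂Ω`. -/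
def MemHOneZero {n : ℕ} {Ω : Set (Euc n)} (u : HOne Ω) : Prop :=
  ∃ φ : ℕ → Euc n → ℝ, (∀ k, IsTestFunction Ω (φ k)) ∧ TendstoHOne φ u

/-- Surface measure on `∂Ω`: the `(n-1)`-dimensional Hausdorff measure, normalized so that it agrees
with Lebesgue measure on hyperplanes (`μH` assigns measure `diam^(n-1)` where the usual
normalization has the volume of the `(n-1)`-dimensional ball of that diameter). -/
def surfaceMeasure {n : ℕ} (Ω : Set (Euc n)) : Measure (Euc n) :=
  (volume (Metric.ball (0 : Euc (n - 1)) (1 / 2))) •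
    (Measure.hausdorffMeasure ((n : ℝ) - 1)).restrict (frontier Ω)

/-- The square of the Sobolev-Slobodeckij seminorm of order `1/2` on the `(n-1)`-dimensional
surface `∂Ω`: `∬ |g(x) - g(y)|² / |x - y|ⁿ dσ(x) dσ(y)`. -/
def slobodeckijSq {n : ℕ} (Ω : Set (Euc n)) (g : Euc n → ℝ) : ℝ≥0∞ :=
  ∫⁻ x, ∫⁻ y, ENNReal.ofReal ((g x - g y) ^ 2) / ENNReal.ofReal (dist x y ^ n)
    ∂(surfaceMeasure Ω) ∂(surfaceMeasure Ω)

/-- The `H^{1/2}(∂Ω)` norm. -/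
def hHalfNorm {n : ℕ} (Ω : Set (Euc n)) (g : Euc n → ℝ) : ℝ≥0∞ :=
  (eLpNorm g 2 (surfaceMeasure Ω) ^ 2 + slobodeckijSq Ω g) ^ (1 / 2 : ℝ)

/-- `g ∈ H^{1/2}(∂Ω)`. -/
def MemHHalf {n : ℕ} (Ω : Set (Euc n)) (g : Euc n → ℝ) : Prop :=
  MemLp g 2 (surfaceMeasure Ω) ∧ slobodeckijSq Ω g < ⊤

/-- The support of (the class of) a function `g` on `∂Ω`: the boundary points having no
neighbourhood in which `g` vanishes almost everywhere. -/
def boundarySupport {n : ℕ} (Ω : Set (Euc n)) (g : Euc n → ℝ) : Set (Euc n) :=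
  {x ∈ frontier Ω | ∀ r : ℝ, 0 < r → ¬ (∀ᵐ y ∂(surfaceMeasure Ω), y ∈ Metric.ball x r → g y = 0)}

/-- `g ∈ H̃^{1/2}(Γ)`: the closure in `H^{1/2}(∂Ω)` of the set of all `f ∈ H^{1/2}(∂Ω)` with
`supp f ⊆ Γ`. -/
def MemHHalfTilde {n : ℕ} (Ω Γ : Set (Euc n)) (g : Euc n → ℝ) : Prop :=
  MemHHalf Ω g ∧ ∀ δ : ℝ≥0∞, 0 < δ →
    ∃ f : Euc n → ℝ, MemHHalf Ω f ∧ boundarySupport Ω f ⊆ Γ ∧ hHalfNorm Ω (fun x => g x - f x) < δ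

/-- `u|_{∂Ω} = g` in the sense of traces: the trace operator `H¹(Ω) → L²(∂Ω)` is the continuous
extension of the restriction map defined on functions that are smooth up to the boundary. -/
def HasTrace {n : ℕ} {Ω : Set (Euc n)} (u : HOne Ω) (g : Euc n → ℝ) : Prop :=
  MemLp g 2 (surfaceMeasure Ω) ∧
  ∃ φ : ℕ → Euc n → ℝ, (∀ k, ContDiff ℝ ∞ (φ k)) ∧ TendstoHOne φ u ∧
    Tendsto (fun k => eLpNorm (fun x => φ k x - g x) 2 (surfaceMeasure Ω)) atTop (𝓝 0)

/-- `∑ᵢⱼ Aᵢⱼ ξᵢ ηⱼ`. -/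
def matForm {n : ℕ} (A : Matrix (Fin n) (Fin n) ℝ) (ξ η : Euc n) : ℝ :=
  ∑ i, ∑ j, A i j * ξ i * η j

/-- `u ∈ H¹(Ω)` solves `L u = ∂ᵢ(aⁱʲ ∂ⱼ u) + c u = F` in `Ω` in the weak sense.  As `a` is
symmetric, this is also the equation `L* u = F`. -/
def IsWeakSolution {n : ℕ} (a : Euc n → Matrix (Fin n) (Fin n) ℝ) (c : Euc n → ℝ)
    {Ω : Set (Euc n)} (u : HOne Ω) (F : Euc n → ℝ) : Prop :=
  ∀ φ : Euc n → ℝ, IsTestFunction Ω φ →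
    (- ∫ x in Ω, matForm (a x) (u.grad x) (∇ φ x)) + ∫ x in Ω, c x * u.toFun x * φ x
      = ∫ x in Ω, F x * φ x

/-- The standing assumptions on the operator `L = ∂ᵢ aⁱʲ ∂ⱼ + c` on `Ω`, with constant `K`. -/
structure IsAdmissibleOperator {n : ℕ} (K : ℝ) (Ω : Set (Euc n))
    (a : Euc n → Matrix (Fin n) (Fin n) ℝ) (c : Euc n → ℝ) : Prop where
  measurable_a : ∀ i j, AEStronglyMeasurable (fun x => a x i j) (volume.restrict Ω)
  measurable_c : AEStronglyMeasurable c (volume.restrict Ω)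
  symm : ∀ᵐ x ∂(volume.restrict Ω), (a x).IsSymm
  elliptic : ∀ᵐ x ∂(volume.restrict Ω), ∀ ξ : Euc n,
    K⁻¹ * ‖ξ‖ ^ 2 ≤ matForm (a x) ξ ξ ∧ matForm (a x) ξ ξ ≤ K * ‖ξ‖ ^ 2
  bound_c : ∀ᵐ x ∂(volume.restrict Ω), |c x| ≤ K
  lipschitz : 3 ≤ n → ∀ i j, ∃ G : Euc n → Euc n,
    AEStronglyMeasurable G (volume.restrict Ω) ∧ HasWeakGradient Ω (fun x => a x i j) G ∧
      ∀ᵐ x ∂(volume.restrict Ω), ‖G x‖ ≤ K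
  /-- `0` is not a Dirichlet eigenvalue of `L` in `Ω`. -/
  not_eigenvalue : ∀ u : HOne Ω, MemHOneZero u → IsWeakSolution a c u (fun _ => 0) →
    u.toFun =ᵐ[volume.restrict Ω] 0

/-- The standing assumptions on the sets `D₁ ⋐ D₂` and `Γ ⊆ ∂D₂`. -/
structure IsAdmissibleGeometry {n : ℕ} (D₁ D₂ Γ : Set (Euc n)) : Prop where
  lipschitz₁ : IsBoundedLipschitz D₁
  lipschitz₂ : IsBoundedLipschitz D₂
  compactly_contained : closure D₁ ⊆ D₂
  connected : IsConnected (D₂ \ closure D₁)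
  nonempty : Γ.Nonempty
  relatively_open : ∃ U : Set (Euc n), IsOpen U ∧ Γ = U ∩ frontier D₂

/-- The conclusion of the quantitative Runge approximation theorem, with parameters `μ` and `C`:
every `h ∈ S₁` can, for every `ε ∈ (0,1)`, be approximated by some `u ∈ S₂` with
`‖h - u‖_{L²(D₁)} ≤ ε ‖h‖_{H¹(D₁)}` and
`‖u‖_{H^{1/2}(∂D₂)} ≤ C exp(C ε^{-μ}) ‖h‖_{L²(D₁)}`.  Here `g` is the trace of `u` on `∂D₂`. -/
def QuantitativeRunge {n : ℕ} (a : Euc n → Matrix (Fin n) (Fin n) ℝ) (c : Euc n → ℝ)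
    (D₁ D₂ Γ : Set (Euc n)) (μ C : ℝ) : Prop :=
  ∀ h : HOne D₁, IsWeakSolution a c h (fun _ => 0) → ∀ ε : ℝ, 0 < ε → ε < 1 →
    ∃ (u : HOne D₂) (g : Euc n → ℝ), IsWeakSolution a c u (fun _ => 0) ∧
      HasTrace u g ∧ MemHHalfTilde D₂ Γ g ∧
      l2Norm D₁ (fun x => h.toFun x - u.toFun x) ≤ ε * hOneNorm h ∧
      hHalfNorm D₂ g ≤ ENNReal.ofReal (C * Real.exp (C * ε ^ (-μ)) * l2Norm D₁ h.toFun)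

/-- The pairing `(∂_ν w, g)_{L²(∂Ω)}` of the weakly defined conormal derivative of a solution of
`L w = F` with `g ∈ H^{1/2}(∂Ω)`, computed with an extension `v ∈ H¹(Ω)` of `g`:
`(aⁱʲ ∂ᵢ w, ∂ⱼ v)_{L²(Ω)} + (F - c w, v)_{L²(Ω)}`.  It does not depend on the choice of `v`. -/
def conormalPairing {n : ℕ} (a : Euc n → Matrix (Fin n) (Fin n) ℝ) (c : Euc n → ℝ)
    {Ω : Set (Euc n)} (F : Euc n → ℝ) (w v : HOne Ω) : ℝ :=
  (∫ x in Ω, matForm (a x) (w.grad x) (v.grad x)) +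
    ∫ x in Ω, (F x - c x * w.toFun x) * v.toFun x

/-- `‖∂_ν w‖_{H^{-1/2}(Γ)}`, where `L w = F` in `Ω` and `H^{-1/2}(Γ)` is the dual of
`H̃^{1/2}(Γ)` with the dual norm. -/
def conormalNorm {n : ℕ} (a : Euc n → Matrix (Fin n) (Fin n) ℝ) (c : Euc n → ℝ)
    {Ω : Set (Euc n)} (Γ : Set (Euc n)) (F : Euc n → ℝ) (w : HOne Ω) : ℝ≥0∞ :=
  ⨆ (v : HOne Ω) (g : Euc n → ℝ) (_ : HasTrace v g) (_ : MemHHalfTilde Ω Γ g)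
    (_ : hHalfNorm Ω g ≤ 1), ENNReal.ofReal |conormalPairing a c F w v|

end

/-! The proof is a duality argument. Let `u` be the Runge approximation of `h`, with trace `g`.
Testing the equation of `u` with `w`, which vanishes on the boundary, turns the pairing of the
conormal derivative of `w` with `g` into the integral of `h u` over `D₁`
(`conormalPairing_eq_integral`). If `u` is within half the norm of `h` in `L²(D₁)`, this integral is
at least `3/8` of the squared norm of `h` (`l2Norm_sq_sub_le_integral_mul`). On the other hand the
pairing is at most the dual norm times the cost `C exp(C ε^(-μ)) ‖h‖` of the approximation
(`ofReal_abs_conormalPairing_le`). Dividing by `‖h‖` gives the estimate. -/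

/-! ### Coefficient matrices and the flux vector. -/

section Matrices

variable {n : ℕ}

lemma matForm_comm {A : Matrix (Fin n) (Fin n) ℝ} (hA : A.IsSymm) (ξ η : Euc n) :
    matForm A ξ η = matForm A η ξ := by
  unfold matForm
  rw [Finset.sum_comm]
  refine Finset.sum_congr rfl fun j _ => Finset.sum_congr rfl fun i _ => ?_
  rw [hA.apply]
  ring

lemma matForm_smul_right (A : Matrix (Fin n) (Fin n) ℝ) (t : ℝ) (ξ η : Euc n) :
    matForm A ξ (t • η) = t * matForm A ξ η := by
  simp only [matForm, Finset.mul_sum, PiLp.smul_apply, smul_eq_mul]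
  refine Finset.sum_congr rfl fun i _ => Finset.sum_congr rfl fun j _ => ?_
  ring

lemma matForm_single (A : Matrix (Fin n) (Fin n) ℝ) (i j : Fin n) :
    matForm A (EuclideanSpace.single i 1) (EuclideanSpace.single j 1) = A i j := by
  simp [matForm]

lemma matForm_add_sub_matForm_sub (A : Matrix (Fin n) (Fin n) ℝ) (ξ η : Euc n) :
    matForm A (ξ + η) (ξ + η) - matForm A (ξ - η) (ξ - η) =
      2 * (matForm A ξ η + matForm A η ξ) := by
  simp only [matForm, Finset.mul_sum, PiLp.add_apply, PiLp.sub_apply,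
    ← Finset.sum_add_distrib, ← Finset.sum_sub_distrib]
  refine Finset.sum_congr rfl fun i _ => Finset.sum_congr rfl fun j _ => ?_
  ring

/-- The entries of a symmetric matrix are bounded by a bound of its nonnegative quadratic form. -/
lemma abs_apply_le_of_matForm_le {A : Matrix (Fin n) (Fin n) ℝ} {K : ℝ} (hK : 0 ≤ K)
    (hA : A.IsSymm) (h₀ : ∀ ξ : Euc n, 0 ≤ matForm A ξ ξ)
    (h₁ : ∀ ξ : Euc n, matForm A ξ ξ ≤ K * ‖ξ‖ ^ 2) (i j : Fin n) : |A i j| ≤ K := by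
  set e : Euc n := EuclideanSpace.single i 1 with he
  set f : Euc n := EuclideanSpace.single j 1 with hf
  have hpol := matForm_add_sub_matForm_sub A e f
  rw [matForm_comm hA f e, he, hf, matForm_single, ← he, ← hf] at hpol
  have hne : ‖e‖ = 1 := by simp [he]
  have hnf : ‖f‖ = 1 := by simp [hf]
  have hadd : ‖e + f‖ ^ 2 ≤ 4 := by nlinarith [norm_add_le e f, norm_nonneg (e + f)]
  have hsub : ‖e - f‖ ^ 2 ≤ 4 := by nlinarith [norm_sub_le e f, norm_nonneg (e - f)]
  have h2 := (h₁ (e + f)).trans (mul_le_mul_of_nonneg_left hadd hK)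
  have h3 := (h₁ (e - f)).trans (mul_le_mul_of_nonneg_left hsub hK)
  have h4 := h₀ (e + f)
  have h5 := h₀ (e - f)
  rw [abs_le]
  constructor <;> linarith

/-- The vector representing the linear form `matForm A ξ`. -/
def matFormVec (A : Matrix (Fin n) (Fin n) ℝ) (ξ : Euc n) : Euc n :=
  WithLp.toLp 2 fun j => ∑ i, A i j * ξ i

lemma inner_matFormVec (A : Matrix (Fin n) (Fin n) ℝ) (ξ η : Euc n) :
    inner ℝ (matFormVec A ξ) η = matForm A ξ η := by
  simp only [matFormVec, matForm, PiLp.inner_apply, RCLike.inner_apply, conj_trivial,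
    Finset.mul_sum]
  rw [Finset.sum_comm]
  refine Finset.sum_congr rfl fun i _ => Finset.sum_congr rfl fun j _ => ?_
  ring

/-- The flux is in `L²`, so the energy form is an `L²` pairing and passes to limits in its second
argument. -/
lemma memLp_matFormVec {m : Measure (Euc n)} {a : Euc n → Matrix (Fin n) (Fin n) ℝ}
    {G : Euc n → Euc n} {K : ℝ} (ha : ∀ i j, AEStronglyMeasurable (fun x => a x i j) m)
    (hK : ∀ i j, ∀ᵐ x ∂m, |a x i j| ≤ K) (hG : MemLp G 2 m) :
    MemLp (fun x => matFormVec (a x) (G x)) 2 m := by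
  refine MemLp.of_eval_piLp fun j => ?_
  refine memLp_finsetSum (p := 2) (μ := m) Finset.univ (f := fun i x => a x i j * G x i) fun i _ => ?_
  refine MemLp.of_le_mul (c := K) (hG.eval_piLp i) ((ha i j).mul (hG.eval_piLp i).1) ?_
  filter_upwards [hK i j] with x hx
  rw [norm_mul]
  exact mul_le_mul_of_nonneg_right hx (norm_nonneg _)

end Matrices

/-! ### Limits of `L²` pairings. -/

section Lp

variable {α : Type*} [MeasurableSpace α] {m : Measure α}

lemma tendsto_integral_inner_of_tendsto_eLpNorm {E : Type*} [NormedAddCommGroup E]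
    [InnerProductSpace ℝ E] {f g : α → E} {ψ : ℕ → α → E} (hf : MemLp f 2 m) (hg : MemLp g 2 m)
    (hψ : ∀ k, AEStronglyMeasurable (ψ k) m)
    (hlim : Tendsto (fun k => eLpNorm (fun x => ψ k x - g x) 2 m) atTop (𝓝 0)) :
    Tendsto (fun k => ∫ x, inner ℝ (f x) (ψ k x) ∂m) atTop (𝓝 (∫ x, inner ℝ (f x) (g x) ∂m)) := by
  have hholder : ∀ {p q : α → E}, AEStronglyMeasurable p m → AEStronglyMeasurable q m →
      eLpNorm (fun x => (inner ℝ (p x) (q x) : ℝ)) 1 m ≤ eLpNorm p 2 m * eLpNorm q 2 m := by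
    intro p q hp hq
    simpa using eLpNorm_le_eLpNorm_mul_eLpNorm'_of_norm (r := 1) (p := 2) (q := 2) hp hq
      (fun x y => (inner ℝ x y : ℝ)) 1
      (Eventually.of_forall fun x => by simpa using norm_inner_le_norm (𝕜 := ℝ) (p x) (q x))
  refine tendsto_integral_of_L1' _ (hf.1.inner hg.1) ?_ ?_
  -- The `ψ k` are only assumed measurable; they lie in `L²` once their distance to `g` is finite.
  · filter_upwards [hlim.eventually (gt_mem_nhds ENNReal.zero_lt_top)] with k hk
    have hmem : MemLp (ψ k) 2 m := by
      have : MemLp (fun x => ψ k x - g x) 2 m := ⟨(hψ k).sub hg.1, hk⟩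
      exact (this.add hg).congr_norm (hψ k) (Eventually.of_forall fun x => by simp)
    rw [← memLp_one_iff_integrable]
    exact ⟨hf.1.inner hmem.1,
      (hholder hf.1 hmem.1).trans_lt (ENNReal.mul_lt_top hf.2 hmem.2)⟩
  · have hzero : Tendsto (fun k => eLpNorm f 2 m * eLpNorm (fun x => ψ k x - g x) 2 m) atTop
        (𝓝 0) := by
      simpa using ENNReal.Tendsto.const_mul hlim (Or.inr hf.2.ne)
    refine tendsto_of_tendsto_of_tendsto_of_le_of_le tendsto_const_nhds hzero
      (fun _ => zero_le) fun k => ?_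
    refine le_trans (le_of_eq ?_) (hholder hf.1 ((hψ k).sub hg.1))
    congr 1
    ext x
    simp [inner_sub_right]

lemma memLp_mul_of_bound {p : ℝ≥0∞} {b f : α → ℝ} {K : ℝ} (hb : AEStronglyMeasurable b m)
    (hK : ∀ᵐ x ∂m, |b x| ≤ K) (hf : MemLp f p m) : MemLp (fun x => b x * f x) p m := by
  refine MemLp.of_le_mul (c := K) hf (hb.mul hf.1) ?_
  filter_upwards [hK] with x hx
  rw [norm_mul]
  exact mul_le_mul_of_nonneg_right hx (norm_nonneg _)

end Lp

/-! ### Gradients of smooth functions. -/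

section Gradient

variable {n : ℕ}

lemma ContDiff.continuous_gradient {φ : Euc n → ℝ} (h : ContDiff ℝ ∞ φ) : Continuous (∇ φ) :=
  (InnerProductSpace.toDual ℝ (Euc n)).symm.continuous.comp (h.continuous_fderiv (by simp))

lemma gradient_const_mul {φ : Euc n → ℝ} (h : ContDiff ℝ ∞ φ) (t : ℝ) (x : Euc n) :
    ∇ (fun y => t * φ y) x = t • ∇ φ x := by
  have hd : DifferentiableAt ℝ φ x := h.differentiable (by simp) x
  simp [gradient, fderiv_const_mul hd t]

end Gradient

/-! ### Homogeneity of traces, boundary norms and the conormal pairing. -/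

section Scaling

variable {n : ℕ} {Ω : Set (Euc n)}

/-- The multiple `t u` of `u ∈ H¹(Ω)`. -/
def HOne.scale (t : ℝ) (u : HOne Ω) : HOne Ω where
  toFun x := t * u.toFun x
  grad x := t • u.grad x
  memLp := u.memLp.const_mul t
  memLp_grad := u.memLp_grad.const_smul t
  weak φ hφ i := by
    simp only [PiLp.smul_apply, smul_eq_mul, mul_assoc, integral_const_mul]
    rw [u.weak φ hφ i, mul_neg]

lemma tendsto_eLpNorm_smul_sub {α E : Type*} [MeasurableSpace α] [NormedAddCommGroup E]
    [NormedSpace ℝ E] {m : Measure α} {f : ℕ → α → E} {g : α → E} (t : ℝ)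
    (h : Tendsto (fun k => eLpNorm (fun x => f k x - g x) 2 m) atTop (𝓝 0)) :
    Tendsto (fun k => eLpNorm (fun x => t • f k x - t • g x) 2 m) atTop (𝓝 0) := by
  have hrw : ∀ k, eLpNorm (fun x => t • f k x - t • g x) 2 m =
      ‖t‖ₑ * eLpNorm (fun x => f k x - g x) 2 m := fun k => by
    rw [← eLpNorm_const_smul]
    simp only [← smul_sub]
    rfl
  simp only [hrw]
  simpa using ENNReal.Tendsto.const_mul h (Or.inr enorm_ne_top)

lemma HasTrace.scale {u : HOne Ω} {g : Euc n → ℝ} (h : HasTrace u g) (t : ℝ) :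
    HasTrace (u.scale t) (fun x => t * g x) := by
  obtain ⟨hg, φ, hφ, ⟨h₀, h₁⟩, h₂⟩ := h
  refine ⟨hg.const_mul t, fun k x => t * φ k x, fun k => contDiff_const.mul (hφ k),
    ⟨tendsto_eLpNorm_smul_sub t h₀, ?_⟩, tendsto_eLpNorm_smul_sub t h₂⟩
  simp only [gradient_const_mul (hφ _)]
  exact tendsto_eLpNorm_smul_sub t h₁

lemma slobodeckijSq_const_mul (t : ℝ) (g : Euc n → ℝ) :
    slobodeckijSq Ω (fun x => t * g x) = ENNReal.ofReal (t ^ 2) * slobodeckijSq Ω g := by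
  have hrw : ∀ x y, ENNReal.ofReal ((t * g x - t * g y) ^ 2) / ENNReal.ofReal (dist x y ^ n) =
      ENNReal.ofReal (t ^ 2) *
        (ENNReal.ofReal ((g x - g y) ^ 2) / ENNReal.ofReal (dist x y ^ n)) := fun x y => by
    rw [← mul_sub, mul_pow, ENNReal.ofReal_mul (sq_nonneg t), mul_div_assoc]
  simp only [slobodeckijSq, hrw, lintegral_const_mul' _ _ ENNReal.ofReal_ne_top]

lemma hHalfNorm_const_mul {t : ℝ} (ht : 0 ≤ t) (g : Euc n → ℝ) :
    hHalfNorm Ω (fun x => t * g x) = ENNReal.ofReal t * hHalfNorm Ω g := by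
  have hL : eLpNorm (fun x => t * g x) 2 (surfaceMeasure Ω) =
      ENNReal.ofReal t * eLpNorm g 2 (surfaceMeasure Ω) := by
    have := eLpNorm_const_smul t g 2 (surfaceMeasure Ω)
    rwa [Real.enorm_eq_ofReal ht] at this
  rw [hHalfNorm, hHalfNorm, hL, slobodeckijSq_const_mul, ENNReal.ofReal_pow ht, mul_pow, ← mul_add,
    ENNReal.mul_rpow_of_nonneg _ _ (by norm_num), ← ENNReal.rpow_natCast, ← ENNReal.rpow_mul]
  norm_num

lemma MemHHalf.const_mul {g : Euc n → ℝ} (h : MemHHalf Ω g) (t : ℝ) :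
    MemHHalf Ω (fun x => t * g x) := by
  refine ⟨h.1.const_mul t, ?_⟩
  rw [slobodeckijSq_const_mul]
  exact ENNReal.mul_lt_top ENNReal.ofReal_lt_top h.2

lemma boundarySupport_const_mul {t : ℝ} (ht : t ≠ 0) (g : Euc n → ℝ) :
    boundarySupport Ω (fun x => t * g x) = boundarySupport Ω g := by
  simp [boundarySupport, ht]

lemma MemHHalfTilde.const_mul {Γ : Set (Euc n)} {g : Euc n → ℝ} (h : MemHHalfTilde Ω Γ g) {t : ℝ}
    (ht : 0 < t) : MemHHalfTilde Ω Γ (fun x => t * g x) := by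
  refine ⟨h.1.const_mul t, fun δ hδ => ?_⟩
  have ht' : ENNReal.ofReal t ≠ 0 := (ENNReal.ofReal_pos.2 ht).ne'
  obtain ⟨f, hf, hsupp, hlt⟩ :=
    h.2 (δ / ENNReal.ofReal t) (ENNReal.div_pos hδ.ne' ENNReal.ofReal_ne_top)
  refine ⟨fun x => t * f x, hf.const_mul t, (boundarySupport_const_mul ht.ne' f).trans_subset hsupp,
    ?_⟩
  simp only [← mul_sub]
  rw [hHalfNorm_const_mul ht.le (fun x => g x - f x), mul_comm]
  exact (ENNReal.lt_div_iff_mul_lt (Or.inl ht') (Or.inl ENNReal.ofReal_ne_top)).1 hlt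

lemma conormalPairing_scale (a : Euc n → Matrix (Fin n) (Fin n) ℝ) (c F : Euc n → ℝ)
    (w v : HOne Ω) (t : ℝ) :
    conormalPairing a c F w (v.scale t) = t * conormalPairing a c F w v := by
  simp only [conormalPairing, HOne.scale, matForm_smul_right, mul_left_comm _ t,
    integral_const_mul, mul_add]

/-- The conormal derivative is bounded on `H̃^{1/2}(Γ)` by its dual norm. -/
lemma ofReal_abs_conormalPairing_le (a : Euc n → Matrix (Fin n) (Fin n) ℝ) (c F : Euc n → ℝ)
    {Γ : Set (Euc n)} (w : HOne Ω) {v : HOne Ω} {g : Euc n → ℝ} (hv : HasTrace v g)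
    (hg : MemHHalfTilde Ω Γ g) {B : ℝ} (hB : 0 < B) (hgB : hHalfNorm Ω g ≤ ENNReal.ofReal B) :
    ENNReal.ofReal |conormalPairing a c F w v| ≤
      ENNReal.ofReal B * conormalNorm a c Γ F w := by
  -- The dual norm is a supremum over the unit ball. Scaling by the bound `B`, not by the norm of
  -- `g`, covers the case where that norm is zero.
  have hB' : 0 < B⁻¹ := inv_pos.2 hB
  have hnorm : hHalfNorm Ω (fun x => B⁻¹ * g x) ≤ 1 := by
    rw [hHalfNorm_const_mul hB'.le]
    refine (mul_le_mul_right hgB _).trans ?_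
    rw [← ENNReal.ofReal_mul hB'.le, inv_mul_cancel₀ hB.ne', ENNReal.ofReal_one]
  have hle : ENNReal.ofReal |conormalPairing a c F w (v.scale B⁻¹)| ≤ conormalNorm a c Γ F w :=
    le_iSup_of_le (v.scale B⁻¹) <| le_iSup_of_le (fun x => B⁻¹ * g x) <|
      le_iSup_of_le (hv.scale _) <| le_iSup_of_le (hg.const_mul hB') <|
        le_iSup_of_le hnorm le_rfl
  refine le_trans (le_of_eq ?_) (mul_le_mul_right hle _)
  rw [conormalPairing_scale, ← ENNReal.ofReal_mul hB.le, abs_mul, abs_of_pos hB',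
    mul_inv_cancel_left₀ hB.ne']

end Scaling

/-! ### Green's formula. -/

section Operator

variable {n : ℕ} {Ω : Set (Euc n)} {K : ℝ} {a : Euc n → Matrix (Fin n) (Fin n) ℝ} {c : Euc n → ℝ}

lemma IsAdmissibleOperator.ae_abs_apply_le (hK : 1 ≤ K) (hL : IsAdmissibleOperator K Ω a c)
    (i j : Fin n) : ∀ᵐ x ∂(volume.restrict Ω), |a x i j| ≤ K := by
  filter_upwards [hL.symm, hL.elliptic] with x hs he
  exact abs_apply_le_of_matForm_le (by linarith) hs
    (fun ξ => (by positivity : 0 ≤ K⁻¹ * ‖ξ‖ ^ 2).trans (he ξ).1) (fun ξ => (he ξ).2) i j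

/-- A weak solution of `L u = 0` may be tested with functions in `H¹₀(Ω)`. -/
lemma IsWeakSolution.integral_matForm_eq (hK : 1 ≤ K) (hL : IsAdmissibleOperator K Ω a c)
    {u w : HOne Ω} (hu : IsWeakSolution a c u (fun _ => 0)) (hw : MemHOneZero w) :
    ∫ x in Ω, matForm (a x) (u.grad x) (w.grad x) =
      ∫ x in Ω, c x * u.toFun x * w.toFun x := by
  obtain ⟨φ, hφ, h₀, h₁⟩ := hw
  have t₁ := tendsto_integral_inner_of_tendsto_eLpNorm
    (memLp_matFormVec hL.measurable_a (hL.ae_abs_apply_le hK) u.memLp_grad) w.memLp_grad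
    (fun k => (hφ k).smooth.continuous_gradient.aestronglyMeasurable) h₁
  have t₀ := tendsto_integral_inner_of_tendsto_eLpNorm
    (memLp_mul_of_bound hL.measurable_c hL.bound_c u.memLp) w.memLp
    (fun k => (hφ k).smooth.continuous.aestronglyMeasurable) h₀
  simp only [inner_matFormVec] at t₁
  simp only [RCLike.inner_apply, conj_trivial, mul_comm _ (c _ * u.toFun _)] at t₀
  -- Both integrals are limits along the test functions `φ k`, for which they agree by the weak
  -- equation.
  refine tendsto_nhds_unique t₁ (t₀.congr fun k => ?_)
  have := hu (φ k) (hφ k)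
  simp only [zero_mul, integral_zero] at this
  linarith

/-- Green's formula for the weakly defined conormal derivative of `w ∈ H¹₀(Ω)`. -/
lemma conormalPairing_eq_integral (hK : 1 ≤ K) (hL : IsAdmissibleOperator K Ω a c)
    {u w : HOne Ω} (hu : IsWeakSolution a c u (fun _ => 0)) (hw : MemHOneZero w)
    {F : Euc n → ℝ} (hF : MemLp F 2 (volume.restrict Ω)) :
    conormalPairing a c F w u = ∫ x in Ω, F x * u.toFun x := by
  have hsymm : ∫ x in Ω, matForm (a x) (w.grad x) (u.grad x) =
      ∫ x in Ω, matForm (a x) (u.grad x) (w.grad x) := by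
    refine integral_congr_ae ?_
    filter_upwards [hL.symm] with x hx using matForm_comm hx _ _
  have hcw := memLp_mul_of_bound hL.measurable_c hL.bound_c w.memLp
  have i₁ : Integrable (fun x => F x * u.toFun x) (volume.restrict Ω) := hF.integrable_mul u.memLp
  have i₂ : Integrable (fun x => c x * w.toFun x * u.toFun x) (volume.restrict Ω) :=
    hcw.integrable_mul u.memLp
  simp only [conormalPairing, sub_mul]
  -- The energy term becomes the integral of `c u w`, which cancels the zeroth-order term of the
  -- pairing.
  rw [integral_sub i₁ i₂, hsymm, hu.integral_matForm_eq hK hL hw]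
  simp only [mul_right_comm (c _) (u.toFun _)]
  ring

end Operator

/-! ### Norm comparisons. -/

section Norms

variable {n : ℕ} {Ω : Set (Euc n)}

lemma l2Norm_sq (f : Euc n → ℝ) : l2Norm Ω f ^ 2 = ∫ x in Ω, f x ^ 2 :=
  Real.sq_sqrt (integral_nonneg fun _ => sq_nonneg _)

lemma l2Norm_le_hOneNorm (u : HOne Ω) : l2Norm Ω u.toFun ≤ hOneNorm u :=
  Real.sqrt_le_sqrt (le_add_of_nonneg_right (integral_nonneg fun _ => sq_nonneg _))

/-- Expand the square of `f - g` and drop `g ^ 2`. -/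
lemma l2Norm_sq_sub_le_integral_mul {f g : Euc n → ℝ} (hf : MemLp f 2 (volume.restrict Ω))
    (hg : MemLp g 2 (volume.restrict Ω)) :
    l2Norm Ω f ^ 2 - l2Norm Ω (fun x => f x - g x) ^ 2 ≤ 2 * ∫ x in Ω, f x * g x := by
  have i₂ : Integrable (fun x => (f x - g x) ^ 2) (volume.restrict Ω) := (hf.sub hg).integrable_sq
  rw [l2Norm_sq, l2Norm_sq, ← integral_sub hf.integrable_sq i₂, ← integral_const_mul]
  refine integral_mono (hf.integrable_sq.sub i₂) ((hf.integrable_mul hg).const_mul 2) fun x => ?_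
  nlinarith [sq_nonneg (g x)]

end Norms

/-! ### The duality argument. -/

theorem proposition3p1 (μ C : ℝ) (hμ : 0 < μ) (hC : 1 < C) :
    ∃ C' : ℝ, 1 < C' ∧
      ∀ (n : ℕ), 2 ≤ n → ∀ (K : ℝ), 1 ≤ K →
      ∀ (D₁ D₂ Γ : Set (Euc n)), IsAdmissibleGeometry D₁ D₂ Γ →
      ∀ (a : Euc n → Matrix (Fin n) (Fin n) ℝ) (c : Euc n → ℝ), IsAdmissibleOperator K D₂ a c →
      QuantitativeRunge a c D₁ D₂ Γ μ C →
      ∀ (h : HOne D₁), IsWeakSolution a c h (fun _ => 0) →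
      ∀ (w : HOne D₂), MemHOneZero w → IsWeakSolution a c w (D₁.indicator h.toFun) →
      ∀ (ε : ℝ), 0 < ε → ε * hOneNorm h ≤ (1 / 2) * l2Norm D₁ h.toFun →
        ENNReal.ofReal (l2Norm D₁ h.toFun) ≤
          ENNReal.ofReal (C' * Real.exp (C' * ε ^ (-μ))) *
            conormalNorm a c Γ (D₁.indicator h.toFun) w := by
  -- The argument yields the factor `8/3 * C`, rounded up to `3 * C`; the exponent only needs `C`.
  refine ⟨3 * C, by linarith, ?_⟩
  intro n _ K hK D₁ D₂ Γ hG a c hL hR h hh w hw _ ε hε hεh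
  set N := l2Norm D₁ h.toFun with hN
  have hN₀ : 0 ≤ N := Real.sqrt_nonneg _
  rcases hN₀.eq_or_lt with hN' | hNpos
  · simp [← hN']
  -- Since `N ≤ hOneNorm h`, the assumption on `ε` forces `ε ≤ 1/2`.
  have hε₁ : ε < 1 := by nlinarith [mul_le_mul_of_nonneg_left (l2Norm_le_hOneNorm h) hε.le]
  obtain ⟨u, g, hu, hug, hgΓ, happ, hgn⟩ := hR h hh ε hε hε₁
  have hsub : D₁ ⊆ D₂ := subset_closure.trans hG.compactly_contained
  have hmeas : MeasurableSet D₁ := hG.lipschitz₁.isOpen.measurableSet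
  have hF : MemLp (D₁.indicator h.toFun) 2 (volume.restrict D₂) :=
    ((memLp_indicator_iff_restrict hmeas).2 h.memLp).restrict D₂
  have hu₁ : MemLp u.toFun 2 (volume.restrict D₁) :=
    u.memLp.mono_measure (Measure.restrict_mono hsub le_rfl)
  have hpair : conormalPairing a c (D₁.indicator h.toFun) w u =
      ∫ x in D₁, h.toFun x * u.toFun x := by
    rw [conormalPairing_eq_integral hK hL hu hw hF]
    simp only [← Set.indicator_mul_left]
    rw [setIntegral_indicator hmeas, Set.inter_eq_right.2 hsub]
  -- The error is at most `N / 2`, so twice the pairing is at least `N ^ 2 - N ^ 2 / 4`.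
  have hlow : 3 / 8 * N ^ 2 ≤ |conormalPairing a c (D₁.indicator h.toFun) w u| := by
    have h₁ := l2Norm_sq_sub_le_integral_mul h.memLp hu₁
    rw [← hpair, ← hN] at h₁
    have h₂ := pow_le_pow_left₀ (Real.sqrt_nonneg _) (happ.trans hεh) 2
    have h₃ := le_abs_self (conormalPairing a c (D₁.indicator h.toFun) w u)
    change l2Norm D₁ _ ^ 2 ≤ _ at h₂
    nlinarith
  have hCpos : 0 < C := by linarith
  have hB : 0 < C * Real.exp (C * ε ^ (-μ)) * N := by positivity
  have hup := ofReal_abs_conormalPairing_le a c (D₁.indicator h.toFun) w hug hgΓ hB hgn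
  have hexp : Real.exp (C * ε ^ (-μ)) ≤ Real.exp (3 * C * ε ^ (-μ)) := by
    have : 0 < ε ^ (-μ) := Real.rpow_pos_of_pos hε _
    exact Real.exp_le_exp.2 (by nlinarith)
  -- The factor `8 / (3 * N)` turns the lower bound `3 / 8 * N ^ 2` into `N` and cancels the `N` in
  -- the cost of the approximation.
  have hconst : 8 / (3 * N) * (C * Real.exp (C * ε ^ (-μ)) * N) ≤
      3 * C * Real.exp (3 * C * ε ^ (-μ)) := by
    have : 8 / (3 * N) * (C * Real.exp (C * ε ^ (-μ)) * N) =
        8 / 3 * C * Real.exp (C * ε ^ (-μ)) := by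
      field_simp
    rw [this]
    exact mul_le_mul (by linarith) hexp (Real.exp_pos _).le (by linarith)
  calc ENNReal.ofReal N
      = ENNReal.ofReal (8 / (3 * N)) * ENNReal.ofReal (3 / 8 * N ^ 2) := by
        rw [← ENNReal.ofReal_mul (by positivity)]
        congr 1
        field_simp
    _ ≤ ENNReal.ofReal (8 / (3 * N)) * (ENNReal.ofReal (C * Real.exp (C * ε ^ (-μ)) * N) *
          conormalNorm a c Γ (D₁.indicator h.toFun) w) :=
        mul_le_mul_right ((ENNReal.ofReal_le_ofReal hlow).trans hup) _
    _ ≤ _ := by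
        rw [← mul_assoc, ← ENNReal.ofReal_mul (by positivity)]
        exact mul_le_mul_left (ENNReal.ofReal_le_ofReal hconst) _
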